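/- Let $n\ge 1$. All manifolds are smooth and may be empty or disconnected; closed means compact without boundary; $\overline{M}$ is $M$ with the opposite orientation; boundaries carry the boundary orientation (outward normal first). If $X,Y$ are compact oriented $n$-manifolds with boundary and $f:\partial X\to\overline{\partial Y}$ is an orientation-preserving diffeomorphism, then $X\cup_f Y$ denotes the closed oriented $n$-manifold obtained by gluing $X$ and $Y$ along $f$ (well defined up to orientation-preserving diffeomorphism): it is the union of smoothly and orientation-preservingly embedded copies of $X$ and $Y$ which meet exactly in their boundaries, identified by $f$. The double of $X$ is $D(X)=X\cup_{\mathrm{id}_{\partial X}}\overline{X}$. Let $\mathbb{M}_n$ be the commutative monoid of closed oriented $n$-manifolds up to orientation-preserving diffeomorphism, under disjoint union, and $\mathcal{G}(\mathbb{M}_n)$ its Grothendieck group. Let $SKK_n$ be the quotient of $\mathcal{G}(\mathbb{M}_n)$ by the subgroup generated by all elements $$[X\cup_f Y]-[X\cup_g Y]-[X'\cup_f Y']+[X'\cup_g Y'],$$ where $X,X'$ are compact oriented $n$-manifolds with the same boundary $\Sigma$, $Y,Y'$ are compact oriented $n$-manifolds with the same boundary $\Sigma'$, and $f,g:\Sigma\to\overline{\Sigma'}$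 are orientation-preserving diffeomorphisms (having boundary $\Sigma$ means that an orientation-preserving identification of $\Sigma$ with the boundary is given). **Lemma.** Let $X_1,X_2,X_3$ be compact oriented $n$-manifolds with boundaries $\Sigma_1,\Sigma_2,\Sigma_3$, and let $f:\Sigma_1\to\Sigma_2$ and $g:\Sigma_2\to\overline{\Sigma_3}$ be orientation-preserving diffeomorphisms. Then in $SKK_n$ $$[X_1\cup_f\overline{X_2}]+[X_2\cup_g X_3]=[X_1\cup_{g\circ f}X_3]+[D(X_2)].$$ -/

import Mathlib

open scoped Manifold ContDiff Topology

universe u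

noncomputable section

namespace CutPaste

/-! ### Orientations of manifolds -/

section Orientation

/-- `v` is a basis of `V` lying in the orientation `o`. (If `V = 0`, the two orientations of `V`
are the two signs, and the empty family is positive for exactly one of them.) -/
def PositiveFrame {V : Type*} [AddCommGroup V] [Module ℝ V] {n : ℕ}
    (o : Orientation ℝ V (Fin n)) (v : Fin n → V) : Prop :=
  ∃ b : Module.Basis (Fin n) ℝ V, ⇑b = v ∧ b.orientation = o

theorem orientation_neg_neg {V : Type*} [AddCommGroup V] [Module ℝ V] {n : ℕ}
    (o : Orientation ℝ V (Fin n)) : - -o = o := by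
  induction o using Module.Ray.ind with
  | h v hv => rw [neg_rayOfNeZero, neg_rayOfNeZero]; simp only [neg_neg]

theorem positiveFrame_neg_basis {V : Type*} [AddCommGroup V] [Module ℝ V] {n : ℕ}
    (b : Module.Basis (Fin n) ℝ V) (o : Orientation ℝ V (Fin n)) :
    PositiveFrame (-o) b ↔ ¬ PositiveFrame o b := by
  have key : ∀ o : Orientation ℝ V (Fin n), PositiveFrame o b ↔ b.orientation = o := by
    intro o
    constructor
    · rintro ⟨c, hc, rfl⟩
      rw [DFunLike.coe_injective hc]
    · intro h
      exact ⟨b, rfl, h⟩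
  rw [key, key]
  have h := b.orientation_ne_iff_eq_neg o
  constructor
  · intro h1 h2
    have : o = -b.orientation := by rw [h1, orientation_neg_neg]
    exact (h.2 this) h2.symm
  · intro h1
    rw [h.1 (fun e => h1 e.symm), orientation_neg_neg]

theorem positiveFrame_neg_zero {V : Type*} [AddCommGroup V] [Module ℝ V]
    (b : Module.Basis (Fin 0) ℝ V) (o : Orientation ℝ V (Fin 0)) (v : Fin 0 → V) :
    PositiveFrame (-o) v ↔ ¬ PositiveFrame o v := by
  rw [Subsingleton.elim v b]
  exact positiveFrame_neg_basis b o

theorem PositiveFrame.flip {V : Type*} [AddCommGroup V] [Module ℝ V] {n : ℕ}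
    {o : Orientation ℝ V (Fin n)} {v : Fin n → V} (h : PositiveFrame o v) (k : Fin n) :
    PositiveFrame (-o) (Function.update v k (-v k)) := by
  obtain ⟨b, rfl, rfl⟩ := h
  refine ⟨b.unitsSMul (Function.update 1 k (-1)), ?_, b.orientation_neg_single k⟩
  funext i
  by_cases hi : i = k
  · subst hi
    simp [Module.Basis.unitsSMul_apply]
  · simp [Module.Basis.unitsSMul_apply, hi]

theorem positiveFrame_neg_flip {V : Type*} [AddCommGroup V] [Module ℝ V] {n : ℕ}
    (o : Orientation ℝ V (Fin n)) (v : Fin n → V) (k : Fin n) :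
    PositiveFrame (-o) v ↔ PositiveFrame o (Function.update v k (-v k)) := by
  constructor
  · intro h
    simpa [orientation_neg_neg] using h.flip k
  · intro h
    simpa using h.flip k

theorem positiveFrame_neg_iff {V W : Type*} [AddCommGroup V] [Module ℝ V] [AddCommGroup W]
    [Module ℝ W] {n : ℕ} (bV : Module.Basis (Fin n) ℝ V) (bW : Module.Basis (Fin n) ℝ W)
    {o : Orientation ℝ V (Fin n)} {o' : Orientation ℝ W (Fin n)} (L : V →ₗ[ℝ] W)
    (h : ∀ v, PositiveFrame o v ↔ PositiveFrame o' (fun i => L (v i))) (v : Fin n → V) :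
    PositiveFrame (-o) v ↔ PositiveFrame (-o') (fun i => L (v i)) := by
  cases n with
  | zero => rw [positiveFrame_neg_zero bV, positiveFrame_neg_zero bW, h]
  | succ n =>
    rw [positiveFrame_neg_flip _ _ 0, positiveFrame_neg_flip _ _ 0, h]
    congr! 1
    funext i
    by_cases hi : i = 0
    · subst hi; simp
    · simp [hi]

variable {n : ℕ} {E H : Type*} [NormedAddCommGroup E] [NormedSpace ℝ E] [TopologicalSpace H]
  (I : ModelWithCorners ℝ E H)
  {E' H' : Type*} [NormedAddCommGroup E'] [NormedSpace ℝ E'] [TopologicalSpace H']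
  (I' : ModelWithCorners ℝ E' H')
  {E'' H'' : Type*} [NormedAddCommGroup E''] [NormedSpace ℝ E''] [TopologicalSpace H'']
  (I'' : ModelWithCorners ℝ E'' H'')
  {M M' M'' : Type*} [TopologicalSpace M] [ChartedSpace H M]

/-- A choice of orientations of all tangent spaces is an orientation of the manifold if it is
locally constant when read in charts. -/
def IsOrientation (o : ∀ x : M, Orientation ℝ (TangentSpace I x) (Fin n)) : Prop :=
  ∀ x₀ : M, ∃ o₀ : Orientation ℝ E (Fin n), ∀ᶠ x in 𝓝 x₀, ∀ v : Fin n → TangentSpace I x,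
    PositiveFrame (o x) v ↔
      PositiveFrame o₀ (fun i => (mfderiv I 𝓘(ℝ, E) (extChartAt I x₀) x (v i) : E))

/-- The differential of `f` carries positive frames, and only those, to positive frames. Between
manifolds of dimension `n` this forces the differential to be bijective at every point. -/
def PreservesOrientation [TopologicalSpace M'] [ChartedSpace H' M']
    (o : ∀ x : M, Orientation ℝ (TangentSpace I x) (Fin n))
    (o' : ∀ y : M', Orientation ℝ (TangentSpace I' y) (Fin n)) (f : M → M') : Prop :=
  ∀ (x : M) (v : Fin n → TangentSpace I x),
    PositiveFrame (o x) v ↔ PositiveFrame (o' (f x)) (fun i => mfderiv I I' f x (v i))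

theorem IsOrientation.neg (bE : Module.Basis (Fin n) ℝ E)
    {o : ∀ x : M, Orientation ℝ (TangentSpace I x) (Fin n)} (h : IsOrientation I o) :
    IsOrientation I (fun x => -o x) := by
  intro x₀
  obtain ⟨o₀, ho⟩ := h x₀
  refine ⟨-o₀, ho.mono fun x hx v => ?_⟩
  exact positiveFrame_neg_iff (V := TangentSpace I x) (W := E) bE bE
    (mfderiv I 𝓘(ℝ, E) (extChartAt I x₀) x).toLinearMap hx v

/-- The orientation of a disjoint union that restricts to the given ones on the two parts
(the tangent space at a point of a part is the tangent space of that part). -/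
def sumOrient {N : Type*} [TopologicalSpace N] [ChartedSpace H N]
    (o : ∀ x : M, Orientation ℝ (TangentSpace I x) (Fin n))
    (o' : ∀ y : N, Orientation ℝ (TangentSpace I y) (Fin n)) :
    ∀ z : M ⊕ N, Orientation ℝ (TangentSpace I z) (Fin n)
  | .inl x => o x
  | .inr y => o' y

theorem preservesOrientation_id (o : ∀ x : M, Orientation ℝ (TangentSpace I x) (Fin n)) :
    PreservesOrientation I I o o id := by
  intro x v
  simp only [mfderiv_id]
  exact Iff.rfl

variable {I I' I''} in
theorem PreservesOrientation.comp [TopologicalSpace M'] [ChartedSpace H' M']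
    [TopologicalSpace M''] [ChartedSpace H'' M'']
    {o : ∀ x : M, Orientation ℝ (TangentSpace I x) (Fin n)}
    {o' : ∀ y : M', Orientation ℝ (TangentSpace I' y) (Fin n)}
    {o'' : ∀ y : M'', Orientation ℝ (TangentSpace I'' y) (Fin n)} {f : M → M'} {g : M' → M''}
    (hg : PreservesOrientation I' I'' o' o'' g) (hf : PreservesOrientation I I' o o' f)
    (dg : MDifferentiable I' I'' g) (df : MDifferentiable I I' f) :
    PreservesOrientation I I'' o o'' (g ∘ f) := by
  intro x v
  rw [hf x v, hg (f x), mfderiv_comp x (dg (f x)) (df x)]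
  exact Iff.rfl

variable {I I'} in
theorem PreservesOrientation.symm [TopologicalSpace M'] [ChartedSpace H' M']
    {o : ∀ x : M, Orientation ℝ (TangentSpace I x) (Fin n)}
    {o' : ∀ y : M', Orientation ℝ (TangentSpace I' y) (Fin n)} (φ : M ≃ₘ⟮I, I'⟯ M')
    (h : PreservesOrientation I I' o o' φ) : PreservesOrientation I' I o' o φ.symm := by
  intro y v
  obtain ⟨x, rfl⟩ : ∃ x, φ x = y := φ.surjective y
  have hx : φ.symm (φ x) = x := φ.symm_apply_apply x
  have d1 : MDifferentiable I I' φ := φ.mdifferentiable (by simp)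
  have d2 : MDifferentiable I' I φ.symm := φ.symm.mdifferentiable (by simp)
  have hc := mfderiv_comp (φ x) (I := I') (I' := I) (I'' := I') (d1 (φ.symm (φ x))) (d2 (φ x))
  have hid : (φ ∘ φ.symm : M' → M') = id := by
    funext z; exact φ.apply_symm_apply z
  rw [hid, mfderiv_id] at hc
  rw [h (φ.symm (φ x))]
  have hv : ∀ i, mfderiv I I' φ (φ.symm (φ x)) (mfderiv I' I φ.symm (φ x) (v i)) = v i := by
    intro i
    have := congrArg (fun L => L (v i)) hc
    exact this.symm
  simp only [hv]
  exact Iff.of_eq (by rw [hx])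

section Sum

variable {N : Type*} [TopologicalSpace N] [ChartedSpace H N]
  {o : ∀ x : M, Orientation ℝ (TangentSpace I x) (Fin n)}
  {o' : ∀ y : N, Orientation ℝ (TangentSpace I y) (Fin n)}

theorem preservesOrientation_inl :
    PreservesOrientation I I o (sumOrient I o o') (Sum.inl : M → M ⊕ N) := by
  intro x v
  rw [mfderiv_sumInl (p := Sum.inl x)]
  exact Iff.rfl

theorem preservesOrientation_inr :
    PreservesOrientation I I o' (sumOrient I o o') (Sum.inr : N → M ⊕ N) := by
  intro x v
  rw [mfderiv_sumInr]
  exact Iff.rfl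

theorem mfderiv_inl_apply [TopologicalSpace M'] [ChartedSpace H' M'] {f : M ⊕ N → M'} {x : M}
    (hf : MDifferentiableAt I I' f (Sum.inl x)) (v : TangentSpace I x) :
    mfderiv I I' (f ∘ Sum.inl) x v = mfderiv I I' f (Sum.inl x) v := by
  rw [mfderiv_comp x hf (ContMDiff.inl (n := 1) |>.mdifferentiable (by simp) x),
    mfderiv_sumInl (p := Sum.inl x)]
  rfl

theorem mfderiv_inr_apply [TopologicalSpace M'] [ChartedSpace H' M'] {f : M ⊕ N → M'} {x : N}
    (hf : MDifferentiableAt I I' f (Sum.inr x)) (v : TangentSpace I x) :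
    mfderiv I I' (f ∘ Sum.inr) x v = mfderiv I I' f (Sum.inr x) v := by
  rw [mfderiv_comp x hf (ContMDiff.inr (n := 1) |>.mdifferentiable (by simp) x),
    mfderiv_sumInr]
  rfl

variable {I I'} in
theorem PreservesOrientation.of_sum [TopologicalSpace M'] [ChartedSpace H' M']
    {o'' : ∀ y : M', Orientation ℝ (TangentSpace I' y) (Fin n)} {f : M ⊕ N → M'}
    (df : MDifferentiable I I' f)
    (h₁ : PreservesOrientation I I' o o'' (f ∘ Sum.inl))
    (h₂ : PreservesOrientation I I' o' o'' (f ∘ Sum.inr)) :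
    PreservesOrientation I I' (sumOrient I o o') o'' f := by
  rintro (x | x) v
  · exact (h₁ x v).trans (iff_of_eq (congrArg (PositiveFrame (o'' (f (Sum.inl x))))
      (funext fun i => mfderiv_inl_apply I I' (df (Sum.inl x)) (v i))))
  · exact (h₂ x v).trans (iff_of_eq (congrArg (PositiveFrame (o'' (f (Sum.inr x))))
      (funext fun i => mfderiv_inr_apply I I' (df (Sum.inr x)) (v i))))

variable {I} in
theorem IsOrientation.sum [IsManifold I 1 M] [IsManifold I 1 N]
    (h : IsOrientation I o) (h' : IsOrientation I o') :
    IsOrientation I (sumOrient I o o') := by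
  rintro (x₀ | x₀)
  · obtain ⟨o₀, ho⟩ := h x₀
    refine ⟨o₀, ?_⟩
    have h1 : ∀ᶠ z in 𝓝 (Sum.inl x₀ : M ⊕ N), z ∈ (extChartAt I (Sum.inl x₀ : M ⊕ N)).source :=
      extChartAt_source_mem_nhds _
    rw [nhds_inl] at h1 ⊢
    rw [Filter.eventually_map] at h1 ⊢
    filter_upwards [ho, h1] with x hx hs v
    refine (hx v).trans ?_
    have hd : MDifferentiableAt I 𝓘(ℝ, E) (extChartAt I (Sum.inl x₀ : M ⊕ N)) (Sum.inl x) :=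
      mdifferentiableAt_extChartAt (by simpa using hs)
    have he : (extChartAt I (Sum.inl x₀ : M ⊕ N)) ∘ Sum.inl = extChartAt I x₀ := by
      funext y; simp
    rw [← he]
    exact iff_of_eq (congrArg (PositiveFrame o₀)
      (funext fun i => mfderiv_inl_apply I 𝓘(ℝ, E) hd (v i)))
  · obtain ⟨o₀, ho⟩ := h' x₀
    refine ⟨o₀, ?_⟩
    have h1 : ∀ᶠ z in 𝓝 (Sum.inr x₀ : M ⊕ N), z ∈ (extChartAt I (Sum.inr x₀ : M ⊕ N)).source :=
      extChartAt_source_mem_nhds _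
    rw [nhds_inr] at h1 ⊢
    rw [Filter.eventually_map] at h1 ⊢
    filter_upwards [ho, h1] with x hx hs v
    refine (hx v).trans ?_
    have hd : MDifferentiableAt I 𝓘(ℝ, E) (extChartAt I (Sum.inr x₀ : M ⊕ N)) (Sum.inr x) :=
      mdifferentiableAt_extChartAt (by simpa using hs)
    have he : (extChartAt I (Sum.inr x₀ : M ⊕ N)) ∘ Sum.inr = extChartAt I x₀ := by
      funext y; simp
    rw [← he]
    exact iff_of_eq (congrArg (PositiveFrame o₀)
      (funext fun i => mfderiv_inr_apply I 𝓘(ℝ, E) hd (v i)))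

end Sum

end Orientation

/-! ### Closed oriented manifolds and their monoid -/

/-- Closed (compact, without boundary) oriented smooth manifolds of dimension `n`, possibly empty
or disconnected. -/
structure ClosedManifold (n : ℕ) : Type (u + 1) where
  carrier : Type u
  [top : TopologicalSpace carrier]
  [t2 : T2Space carrier]
  [compact : CompactSpace carrier]
  [charted : ChartedSpace (EuclideanSpace ℝ (Fin n)) carrier]
  [smooth : IsManifold (𝓡 n) ∞ carrier]
  orient : ∀ x : carrier, Orientation ℝ (TangentSpace (𝓡 n) x) (Fin n)
  isOrientation : IsOrientation (𝓡 n) orient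

namespace ClosedManifold

attribute [instance] top t2 compact charted smooth

instance (n : ℕ) : CoeSort (ClosedManifold.{u} n) (Type u) := ⟨carrier⟩

/-- The same manifold with the opposite orientation. -/
abbrev reverse {n : ℕ} (M : ClosedManifold.{u} n) : ClosedManifold.{u} n where
  carrier := M.carrier
  orient := fun x => -M.orient x
  isOrientation := M.isOrientation.neg _ (EuclideanSpace.basisFun (Fin n) ℝ).toBasis

/-- Disjoint union. -/
abbrev sum {n : ℕ} (M N : ClosedManifold.{u} n) : ClosedManifold.{u} n where
  carrier := M.carrier ⊕ N.carrier
  orient := sumOrient (𝓡 n) M.orient N.orient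
  isOrientation :=
    haveI : IsManifold (𝓡 n) 1 M.carrier := .of_le (n := ∞) (by simp)
    haveI : IsManifold (𝓡 n) 1 N.carrier := .of_le (n := ∞) (by simp)
    M.isOrientation.sum N.isOrientation

/-- The empty manifold. -/
def empty (n : ℕ) : ClosedManifold.{u} n where
  carrier := PEmpty.{u + 1}
  charted := ChartedSpace.empty (EuclideanSpace ℝ (Fin n)) PEmpty.{u + 1}
  smooth := letI := ChartedSpace.empty (EuclideanSpace ℝ (Fin n)) PEmpty.{u + 1}; inferInstance
  orient := fun x => x.elim
  isOrientation := fun x => x.elim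

/-- Orientation-preserving diffeomorphism. -/
def OrientedDiffeomorphic {n : ℕ} (M N : ClosedManifold.{u} n) : Prop :=
  ∃ φ : M ≃ₘ⟮𝓡 n, 𝓡 n⟯ N, PreservesOrientation (𝓡 n) (𝓡 n) M.orient N.orient φ

instance setoid (n : ℕ) : Setoid (ClosedManifold.{u} n) where
  r := OrientedDiffeomorphic
  iseqv :=
    { refl := fun M => ⟨Diffeomorph.refl _ _ _, preservesOrientation_id _ _⟩
      symm := fun ⟨φ, h⟩ => ⟨φ.symm, h.symm φ⟩
      trans := fun ⟨φ, h⟩ ⟨ψ, k⟩ => ⟨φ.trans ψ,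
        k.comp h (ψ.mdifferentiable (by simp)) (φ.mdifferentiable (by simp))⟩ }

theorem mdiff_inl {n : ℕ} (M N : ClosedManifold.{u} n) :
    MDifferentiable (𝓡 n) (𝓡 n) (Sum.inl : M → M ⊕ N) :=
  (ContMDiff.inl (n := 1)).mdifferentiable (by simp)

theorem mdiff_inr {n : ℕ} (M N : ClosedManifold.{u} n) :
    MDifferentiable (𝓡 n) (𝓡 n) (Sum.inr : N → M ⊕ N) :=
  (ContMDiff.inr (n := 1)).mdifferentiable (by simp)

theorem sum_congr {n : ℕ} {M M' N N' : ClosedManifold.{u} n} (h : M ≈ M') (k : N ≈ N') :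
    M.sum N ≈ M'.sum N' := by
  obtain ⟨φ, hφ⟩ := h
  obtain ⟨ψ, hψ⟩ := k
  refine ⟨Diffeomorph.sumCongr φ ψ, PreservesOrientation.of_sum
    ((Diffeomorph.sumCongr φ ψ).mdifferentiable (by simp)) ?_ ?_⟩
  · exact (preservesOrientation_inl (𝓡 n)).comp hφ (mdiff_inl _ _) (φ.mdifferentiable (by simp))
  · exact (preservesOrientation_inr (𝓡 n)).comp hψ (mdiff_inr _ _) (ψ.mdifferentiable (by simp))

theorem sum_comm {n : ℕ} (M N : ClosedManifold.{u} n) : M.sum N ≈ N.sum M :=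
  ⟨Diffeomorph.sumComm _ _ _ _, PreservesOrientation.of_sum
    ((Diffeomorph.sumComm _ _ _ _).mdifferentiable (by simp))
    (preservesOrientation_inr (𝓡 n)) (preservesOrientation_inl (𝓡 n))⟩

theorem sum_assoc {n : ℕ} (M N P : ClosedManifold.{u} n) :
    (M.sum N).sum P ≈ M.sum (N.sum P) := by
  have d := (Diffeomorph.sumAssoc (𝓡 n) M ∞ N P).mdifferentiable (by simp)
  refine ⟨Diffeomorph.sumAssoc _ _ _ _ _, PreservesOrientation.of_sum d
    (PreservesOrientation.of_sum (d.comp (mdiff_inl (M.sum N) P)) ?_ ?_) ?_⟩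
  · exact preservesOrientation_inl (𝓡 n)
  · exact (preservesOrientation_inr (𝓡 n)).comp (preservesOrientation_inl (𝓡 n))
      (mdiff_inr M (N.sum P)) (mdiff_inl N P)
  · exact (preservesOrientation_inr (𝓡 n)).comp (preservesOrientation_inr (𝓡 n))
      (mdiff_inr M (N.sum P)) (mdiff_inr N P)

theorem sum_empty {n : ℕ} (M : ClosedManifold.{u} n) : M.sum (empty n) ≈ M :=
  haveI : IsEmpty (empty.{u} n).carrier := inferInstanceAs (IsEmpty PEmpty.{u + 1})
  ⟨Diffeomorph.sumEmpty (M' := (empty.{u} n).carrier) (𝓡 n) M ∞, PreservesOrientation.of_sum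
    ((Diffeomorph.sumEmpty (M' := (empty.{u} n).carrier) (𝓡 n) M ∞).mdifferentiable (by simp))
    (preservesOrientation_id _ _) (fun x => isEmptyElim x)⟩

end ClosedManifold

/-- Oriented diffeomorphism classes of closed oriented `n`-manifolds. -/
def ManifoldClass (n : ℕ) : Type (u + 1) := Quotient (ClosedManifold.setoid.{u} n)

/-- Disjoint union. -/
instance (n : ℕ) : Add (ManifoldClass.{u} n) where
  add := Quotient.map₂ ClosedManifold.sum fun _ _ h _ _ k => ClosedManifold.sum_congr h k

/-- The class of the empty manifold. -/
instance (n : ℕ) : Zero (ManifoldClass.{u} n) where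
  zero := Quotient.mk _ (ClosedManifold.empty n)

instance (n : ℕ) : AddCommMonoid (ManifoldClass.{u} n) where
  add_assoc := by
    rintro ⟨M⟩ ⟨N⟩ ⟨P⟩
    exact Quotient.sound (ClosedManifold.sum_assoc M N P)
  add_comm := by
    rintro ⟨M⟩ ⟨N⟩
    exact Quotient.sound (ClosedManifold.sum_comm M N)
  zero_add := by
    rintro ⟨M⟩
    exact Quotient.sound (Setoid.trans (ClosedManifold.sum_comm _ M) (ClosedManifold.sum_empty M))
  add_zero := by
    rintro ⟨M⟩
    exact Quotient.sound (ClosedManifold.sum_empty M)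
  nsmul := nsmulRec

/-- The Grothendieck group of the monoid of closed oriented `n`-manifolds. -/
abbrev ManifoldGroup (n : ℕ) : Type (u + 1) := Algebra.GrothendieckAddGroup (ManifoldClass.{u} n)

/-- The class of a closed oriented manifold in the Grothendieck group. -/
def ManifoldGroup.mk {n : ℕ} (M : ClosedManifold.{u} n) : ManifoldGroup.{u} n :=
  Algebra.GrothendieckAddGroup.of (Quotient.mk (ClosedManifold.setoid n) M)

/-! ### Manifolds with boundary, gluing and doubles -/

/-- At a boundary point `x` of a manifold modelled on the half-space `{y | 0 ≤ y 0}`, the tangent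
vectors that point out of the manifold. -/
def IsOutward {m : ℕ} {X : Type*} [TopologicalSpace X]
    [ChartedSpace (EuclideanHalfSpace (m + 1)) X] (x : X)
    (ν : TangentSpace (𝓡∂ (m + 1)) x) : Prop :=
  let w : EuclideanSpace ℝ (Fin (m + 1)) :=
    mfderiv (𝓡∂ (m + 1)) 𝓘(ℝ, EuclideanSpace ℝ (Fin (m + 1))) (extChartAt (𝓡∂ (m + 1)) x) x ν
  w 0 < 0

/-- Compact oriented smooth `(m + 1)`-manifolds with boundary `S`: the closed oriented
`m`-manifold `S` is identified by `incl` with the boundary, with its boundary orientation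
(outward normal first). -/
structure ManifoldWithBoundary {m : ℕ} (S : ClosedManifold.{u} m) : Type (u + 1) where
  carrier : Type u
  [top : TopologicalSpace carrier]
  [t2 : T2Space carrier]
  [compact : CompactSpace carrier]
  [charted : ChartedSpace (EuclideanHalfSpace (m + 1)) carrier]
  [smooth : IsManifold (𝓡∂ (m + 1)) ∞ carrier]
  orient : ∀ x : carrier, Orientation ℝ (TangentSpace (𝓡∂ (m + 1)) x) (Fin (m + 1))
  isOrientation : IsOrientation (𝓡∂ (m + 1)) orient
  /-- The identification of `S` with the boundary, a smooth embedding. -/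
  incl : S → carrier
  contMDiff_incl : ContMDiff (𝓡 m) (𝓡∂ (m + 1)) ∞ incl
  isEmbedding_incl : Topology.IsEmbedding incl
  mfderiv_incl_injective : ∀ s, Function.Injective (mfderiv (𝓡 m) (𝓡∂ (m + 1)) incl s)
  range_incl : Set.range incl = (𝓡∂ (m + 1)).boundary carrier
  boundary_orient : ∀ (s : S) (ν : TangentSpace (𝓡∂ (m + 1)) (incl s)), IsOutward (incl s) ν →
    ∀ v : Fin m → TangentSpace (𝓡 m) s, PositiveFrame (S.orient s) v ↔
      PositiveFrame (orient (incl s))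
        (Fin.cons ν fun i => mfderiv (𝓡 m) (𝓡∂ (m + 1)) incl s (v i))

namespace ManifoldWithBoundary

attribute [instance] top t2 compact charted smooth

instance {m : ℕ} (S : ClosedManifold.{u} m) :
    CoeSort (ManifoldWithBoundary S) (Type u) := ⟨carrier⟩

/-- Reversing the orientation of a manifold reverses the orientation of its boundary. -/
theorem boundary_orient_neg {m : ℕ} {S : ClosedManifold.{u} m} (X : ManifoldWithBoundary S)
    (s : S) (ν : TangentSpace (𝓡∂ (m + 1)) (X.incl s)) (hν : IsOutward (X.incl s) ν)
    (v : Fin m → TangentSpace (𝓡 m) s) : PositiveFrame (-S.orient s) v ↔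
      PositiveFrame (-X.orient (X.incl s))
        (Fin.cons ν fun i => mfderiv (𝓡 m) (𝓡∂ (m + 1)) X.incl s (v i)) := by
  cases m with
  | zero =>
    refine (positiveFrame_neg_zero (V := TangentSpace (𝓡 0) s)
      (EuclideanSpace.basisFun (Fin 0) ℝ).toBasis _ v).trans ?_
    refine (not_congr (X.boundary_orient s ν hν v)).trans ?_
    have hν0 : ν ≠ 0 := by
      rintro rfl
      unfold IsOutward at hν
      rw [map_zero] at hν
      exact lt_irrefl (0 : ℝ) hν
    let V := EuclideanSpace ℝ (Fin (0 + 1))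
    let w : Fin (0 + 1) → V := Fin.cons ν fun i => mfderiv (𝓡 0) (𝓡∂ (0 + 1)) X.incl s (v i)
    have hw : LinearIndependent ℝ w := by
      exact (linearIndependent_unique_iff (ι := Fin 1) (v := w)).2 hν0
    let b := basisOfLinearIndependentOfCardEqFinrank hw (by simp [V])
    have hb : ⇑b = w := coe_basisOfLinearIndependentOfCardEqFinrank hw _
    have := positiveFrame_neg_basis (V := V) b (X.orient (X.incl s))
    rw [hb] at this
    exact this.symm
  | succ m =>
    rw [positiveFrame_neg_flip _ _ 0, X.boundary_orient s ν hν,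
      positiveFrame_neg_flip _ _ (Fin.succ 0)]
    refine iff_of_eq (congrArg (PositiveFrame (X.orient (X.incl s))) (funext fun i => ?_))
    refine Fin.cases ?_ (fun i => ?_) i
    · rfl
    · by_cases hi : i = 0
      · subst hi; simp
      · rw [Function.update_of_ne (fun h => hi (Fin.succ_injective _ h))]
        simp [hi]

/-- The same manifold with the opposite orientation; its boundary is `S.reverse`. -/
abbrev reverse {m : ℕ} {S : ClosedManifold.{u} m} (X : ManifoldWithBoundary S) :
    ManifoldWithBoundary S.reverse where
  carrier := X.carrier
  orient := fun x => -X.orient x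
  isOrientation := X.isOrientation.neg _ (EuclideanSpace.basisFun (Fin (m + 1)) ℝ).toBasis
  incl := X.incl
  contMDiff_incl := X.contMDiff_incl
  isEmbedding_incl := X.isEmbedding_incl
  mfderiv_incl_injective := X.mfderiv_incl_injective
  range_incl := X.range_incl
  boundary_orient := X.boundary_orient_neg

end ManifoldWithBoundary

/-- `i` is an orientation-preserving smooth embedding of `X` as a codimension-`0` submanifold with
boundary of the closed manifold `M` (see `PreservesOrientation` for the differential). -/
structure IsOrientedEmbedding {m : ℕ} {S : ClosedManifold.{u} m} (X : ManifoldWithBoundary S)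
    (M : ClosedManifold.{u} (m + 1)) (i : X → M) : Prop where
  contMDiff : ContMDiff (𝓡∂ (m + 1)) (𝓡 (m + 1)) ∞ i
  isEmbedding : Topology.IsEmbedding i
  preservesOrientation : PreservesOrientation (𝓡∂ (m + 1)) (𝓡 (m + 1)) X.orient M.orient i

/-- `M` is a manifold `X ∪_f Y` obtained by gluing `X` and `Y` along the diffeomorphism `f` of
their boundaries: `M` is the union of an embedded copy of `X` and an embedded copy of `Y` which
meet exactly in their boundaries, identified by `f`. (The smooth structure of the glued manifold is
unique only up to diffeomorphism, so this is a property of `M`.) -/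
def IsGluing {m : ℕ} {S T : ClosedManifold.{u} m} (X : ManifoldWithBoundary S)
    (Y : ManifoldWithBoundary T) (f : S ≃ₘ⟮𝓡 m, 𝓡 m⟯ T) (M : ClosedManifold.{u} (m + 1)) : Prop :=
  ∃ (i : X → M) (j : Y → M), IsOrientedEmbedding X M i ∧ IsOrientedEmbedding Y M j ∧
    Set.range i ∪ Set.range j = Set.univ ∧
    ∀ x y, i x = j y ↔ ∃ s : S, X.incl s = x ∧ Y.incl (f s) = y

/-- `D` is the double of `X`, the gluing of `X` and its reverse along the identity. -/
def IsDouble {m : ℕ} {S : ClosedManifold.{u} m} (X : ManifoldWithBoundary S)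
    (D : ClosedManifold.{u} (m + 1)) : Prop :=
  IsGluing X X.reverse (Diffeomorph.refl (𝓡 m) S ∞) D

/-! ### The SKK groups -/

/-- `f` is an orientation-preserving diffeomorphism from `S` to `T`. -/
def IsOrientedDiffeo {m : ℕ} (S T : ClosedManifold.{u} m) (f : S ≃ₘ⟮𝓡 m, 𝓡 m⟯ T) : Prop :=
  PreservesOrientation (𝓡 m) (𝓡 m) S.orient T.orient f

/-- The elements `[X₁ ∪_f X₂] - [X₁ ∪_g X₂] - [Y₁ ∪_f Y₂] + [Y₁ ∪_g Y₂]`, where `X₁`, `Y₁` have the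
same boundary `S`, where `X₂`, `Y₂` have the same boundary `T`, and where `f`, `g` are
orientation-preserving diffeomorphisms from `S` to the reverse of `T`. In dimension `0` all
boundaries are empty and there is nothing to impose. -/
def skkRelators : (n : ℕ) → Set (ManifoldGroup.{u} n)
  | 0 => ∅
  | m + 1 => {r | ∃ (S T : ClosedManifold.{u} m) (X₁ Y₁ : ManifoldWithBoundary S)
      (X₂ Y₂ : ManifoldWithBoundary T) (f g : S ≃ₘ⟮𝓡 m, 𝓡 m⟯ T)
      (M N M' N' : ClosedManifold.{u} (m + 1)),
      IsOrientedDiffeo S T.reverse f ∧ IsOrientedDiffeo S T.reverse g ∧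
      IsGluing X₁ X₂ f M ∧ IsGluing X₁ X₂ g N ∧ IsGluing Y₁ Y₂ f M' ∧ IsGluing Y₁ Y₂ g N' ∧
      r = ManifoldGroup.mk M - ManifoldGroup.mk N - ManifoldGroup.mk M' + ManifoldGroup.mk N'}

/-- The group `SKK_n`. -/
abbrev SKK (n : ℕ) : Type (u + 1) :=
  ManifoldGroup.{u} n ⧸ AddSubgroup.closure (skkRelators.{u} n)

/-- The class of a closed oriented manifold in `SKK_n`. -/
def SKK.mk {n : ℕ} (M : ClosedManifold.{u} n) : SKK.{u} n :=
  QuotientAddGroup.mk (ManifoldGroup.mk M)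

end CutPaste

end

/-! An SKK relator says that the difference between gluing along one map and gluing along another
does not depend on the pieces. Put the left piece `X₁ ⊔ X₂` against the right piece `X₂.reverse ⊔
X₃`. Gluing along `f ⊔ g` pairs the summands in order and gives `A ⊔ B`; gluing along `(g ∘ f) ⊔
id`, with the targets crossed, pairs `X₁` with `X₃` and `X₂` with its reverse and gives `C ⊔ D`.

Now replace `X₁` by a copy of `X₂` whose boundary is labelled by `S₁` through `f`. The two maps then
give `D ⊔ B` and `B ⊔ D`, which have the same class. The relator therefore reduces to `[A] + [B] =
[C] + [D]`.

What has to be checked is that gluings are compatible with disjoint union (`IsGluing.sum`), with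
exchanging the right-hand summands (`IsGluing.trans_sumComm`) and with relabelling the boundary
(`IsGluing.reparam`), and that the gluing maps reverse orientation correctly. `SKK.mk_add_mk_eq`
then supplies the relation. -/

namespace CutPaste

/-! ### Disjoint unions of manifolds with boundary -/

/-- Outward vectors of a disjoint union, on the left part. -/
theorem isOutward_inl {m : ℕ} {X Y : Type*} [TopologicalSpace X] [TopologicalSpace Y]
    [ChartedSpace (EuclideanHalfSpace (m + 1)) X] [ChartedSpace (EuclideanHalfSpace (m + 1)) Y]
    [IsManifold (𝓡∂ (m + 1)) 1 X] [IsManifold (𝓡∂ (m + 1)) 1 Y] (x : X)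
    (ν : TangentSpace (𝓡∂ (m + 1)) x) :
    IsOutward (Sum.inl x : X ⊕ Y) ν ↔ IsOutward x ν := by
  have hd : MDifferentiableAt (𝓡∂ (m + 1)) 𝓘(ℝ, EuclideanSpace ℝ (Fin (m + 1)))
      (extChartAt (𝓡∂ (m + 1)) (Sum.inl x : X ⊕ Y)) (Sum.inl x) :=
    mdifferentiableAt_extChartAt (mem_chart_source _ _)
  have he : extChartAt (𝓡∂ (m + 1)) (Sum.inl x : X ⊕ Y) ∘ Sum.inl =
      extChartAt (𝓡∂ (m + 1)) x := by
    funext y; simp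
  have h := mfderiv_inl_apply (𝓡∂ (m + 1)) _ hd ν
  rw [he] at h
  unfold IsOutward
  rw [h]

/-- Outward vectors of a disjoint union, on the right part. -/
theorem isOutward_inr {m : ℕ} {X Y : Type*} [TopologicalSpace X] [TopologicalSpace Y]
    [ChartedSpace (EuclideanHalfSpace (m + 1)) X] [ChartedSpace (EuclideanHalfSpace (m + 1)) Y]
    [IsManifold (𝓡∂ (m + 1)) 1 X] [IsManifold (𝓡∂ (m + 1)) 1 Y] (y : Y)
    (ν : TangentSpace (𝓡∂ (m + 1)) y) :
    IsOutward (Sum.inr y : X ⊕ Y) ν ↔ IsOutward y ν := by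
  have hd : MDifferentiableAt (𝓡∂ (m + 1)) 𝓘(ℝ, EuclideanSpace ℝ (Fin (m + 1)))
      (extChartAt (𝓡∂ (m + 1)) (Sum.inr y : X ⊕ Y)) (Sum.inr y) :=
    mdifferentiableAt_extChartAt (mem_chart_source _ _)
  have he : extChartAt (𝓡∂ (m + 1)) (Sum.inr y : X ⊕ Y) ∘ Sum.inr =
      extChartAt (𝓡∂ (m + 1)) y := by
    funext z; simp
  have h := mfderiv_inr_apply (𝓡∂ (m + 1)) _ hd ν
  rw [he] at h
  unfold IsOutward
  rw [h]

/-! ### Differentials and orientations under sums of maps -/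

section SumMap

variable {E H E' H' M N M' N' : Type*} [NormedAddCommGroup E] [NormedSpace ℝ E]
  [TopologicalSpace H] (I : ModelWithCorners ℝ E H) [NormedAddCommGroup E'] [NormedSpace ℝ E']
  [TopologicalSpace H'] (I' : ModelWithCorners ℝ E' H')
  [TopologicalSpace M] [ChartedSpace H M] [TopologicalSpace N] [ChartedSpace H N]
  [TopologicalSpace M'] [ChartedSpace H' M'] [TopologicalSpace N'] [ChartedSpace H' N']

/-- The differential of `Sum.inl` is the identity, so this is the chain rule for both sides of
`Sum.map f g ∘ Sum.inl = Sum.inl ∘ f`. Tangent spaces of a summand and of the union are the same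
type, so the two vectors can be compared directly. -/
theorem mfderiv_sumMap_inl {f : M → M'} {g : N → N'} (hf : MDifferentiable I I' f)
    (h : MDifferentiable I I' (Sum.map f g)) (x : M) (v : TangentSpace I x) :
    mfderiv I I' (Sum.map f g) (Sum.inl x) v = mfderiv I I' f x v := by
  refine (mfderiv_inl_apply I I' (h (Sum.inl x)) v).symm.trans ?_
  have hi : MDifferentiableAt I' I' (Sum.inl : M' → M' ⊕ N') (f x) :=
    (ContMDiff.inl (n := 1)).mdifferentiable (by simp) (f x)
  rw [show Sum.map f g ∘ Sum.inl = Sum.inl ∘ f from rfl, mfderiv_comp x hi (hf x),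
    mfderiv_sumInl (p := Sum.inl (f x))]
  rfl

theorem mfderiv_sumMap_inr {f : M → M'} {g : N → N'} (hg : MDifferentiable I I' g)
    (h : MDifferentiable I I' (Sum.map f g)) (y : N) (v : TangentSpace I y) :
    mfderiv I I' (Sum.map f g) (Sum.inr y) v = mfderiv I I' g y v := by
  refine (mfderiv_inr_apply I I' (h (Sum.inr y)) v).symm.trans ?_
  have hi : MDifferentiableAt I' I' (Sum.inr : N' → M' ⊕ N') (g y) :=
    (ContMDiff.inr (n := 1)).mdifferentiable (by simp) (g y)
  rw [show Sum.map f g ∘ Sum.inr = Sum.inr ∘ g from rfl, mfderiv_comp y hi (hg y), mfderiv_sumInr]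
  rfl

variable {n : ℕ} {o₁ : ∀ x : M, Orientation ℝ (TangentSpace I x) (Fin n)}
  {o₂ : ∀ x : N, Orientation ℝ (TangentSpace I x) (Fin n)}
  {o₁' : ∀ x : M', Orientation ℝ (TangentSpace I' x) (Fin n)}
  {o₂' : ∀ x : N', Orientation ℝ (TangentSpace I' x) (Fin n)}

variable {I I'} in
theorem PreservesOrientation.sumMap {f : M → M'} {g : N → N'}
    (hf : PreservesOrientation I I' o₁ o₁' f) (hg : PreservesOrientation I I' o₂ o₂' g)
    (df : ContMDiff I I' ∞ f) (dg : ContMDiff I I' ∞ g) :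
    PreservesOrientation I I' (sumOrient I o₁ o₂) (sumOrient I' o₁' o₂') (Sum.map f g) :=
  .of_sum ((df.sumMap dg).mdifferentiable (by simp))
    ((preservesOrientation_inl I').comp hf ((ContMDiff.inl (n := 1)).mdifferentiable (by simp))
      (df.mdifferentiable (by simp)))
    ((preservesOrientation_inr I').comp hg ((ContMDiff.inr (n := 1)).mdifferentiable (by simp))
      (dg.mdifferentiable (by simp)))

theorem preservesOrientation_swap :
    PreservesOrientation I I (sumOrient I o₁ o₂) (sumOrient I o₂ o₁)
      (Sum.swap : M ⊕ N → N ⊕ M) :=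
  .of_sum ((ContMDiff.swap (n := 1)).mdifferentiable (by simp))
    (preservesOrientation_inr I) (preservesOrientation_inl I)

/-- Gluing maps land in reversed boundaries; this identifies the union of two reversed boundaries
with the reverse of their union. -/
theorem sumOrient_neg :
    sumOrient I (fun x => -o₁ x) (fun x => -o₂ x) = fun z => -sumOrient I o₁ o₂ z := by
  funext z
  cases z <;> rfl

end SumMap

/-! ### Disjoint union and relabelled boundary -/

namespace ManifoldWithBoundary

variable {m : ℕ} {S T : ClosedManifold.{u} m}

instance isManifold_one (X : ManifoldWithBoundary S) : IsManifold (𝓡∂ (m + 1)) 1 X :=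
  .of_le (n := ∞) (by simp)

theorem mdifferentiable_incl (X : ManifoldWithBoundary S) :
    MDifferentiable (𝓡 m) (𝓡∂ (m + 1)) X.incl :=
  X.contMDiff_incl.mdifferentiable (by simp)

theorem contMDiff_sumMap_incl (X : ManifoldWithBoundary S) (Y : ManifoldWithBoundary T) :
    ContMDiff (𝓡 m) (𝓡∂ (m + 1)) ∞ (Sum.map X.incl Y.incl) :=
  X.contMDiff_incl.sumMap Y.contMDiff_incl

theorem mfderiv_sumMap_incl_inl (X : ManifoldWithBoundary S) (Y : ManifoldWithBoundary T)
    (s : S) (v : TangentSpace (𝓡 m) s) :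
    mfderiv (𝓡 m) (𝓡∂ (m + 1)) (Sum.map X.incl Y.incl) (Sum.inl s) v =
      mfderiv (𝓡 m) (𝓡∂ (m + 1)) X.incl s v :=
  mfderiv_sumMap_inl _ _ X.mdifferentiable_incl
    ((X.contMDiff_sumMap_incl Y).mdifferentiable (by simp)) s v

theorem mfderiv_sumMap_incl_inr (X : ManifoldWithBoundary S) (Y : ManifoldWithBoundary T)
    (t : T) (v : TangentSpace (𝓡 m) t) :
    mfderiv (𝓡 m) (𝓡∂ (m + 1)) (Sum.map X.incl Y.incl) (Sum.inr t) v =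
      mfderiv (𝓡 m) (𝓡∂ (m + 1)) Y.incl t v :=
  mfderiv_sumMap_inr _ _ Y.mdifferentiable_incl
    ((X.contMDiff_sumMap_incl Y).mdifferentiable (by simp)) t v

/-- Disjoint union. -/
noncomputable abbrev sum (X : ManifoldWithBoundary S) (Y : ManifoldWithBoundary T) :
    ManifoldWithBoundary (S.sum T) where
  carrier := X.carrier ⊕ Y.carrier
  orient := sumOrient (𝓡∂ (m + 1)) X.orient Y.orient
  isOrientation := X.isOrientation.sum Y.isOrientation
  incl := Sum.map X.incl Y.incl
  contMDiff_incl := X.contMDiff_sumMap_incl Y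
  -- A continuous injection from a compact space to a Hausdorff space is a closed embedding.
  isEmbedding_incl := ((X.contMDiff_sumMap_incl Y).continuous.isClosedEmbedding
    (X.isEmbedding_incl.injective.sumMap Y.isEmbedding_incl.injective)).isEmbedding
  mfderiv_incl_injective := by
    rintro (s | t) v w h
    · refine X.mfderiv_incl_injective s ?_
      rw [← mfderiv_sumMap_incl_inl X Y s v, ← mfderiv_sumMap_incl_inl X Y s w]
      exact h
    · refine Y.mfderiv_incl_injective t ?_
      rw [← mfderiv_sumMap_incl_inr X Y t v, ← mfderiv_sumMap_incl_inr X Y t w]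
      exact h
  range_incl := by
    rw [ModelWithCorners.boundary_disjointUnion, ← X.range_incl, ← Y.range_incl]
    ext (x | y) <;> simp
  boundary_orient := by
    rintro (s | t) ν hν v
    · refine (X.boundary_orient s ν ((isOutward_inl _ _).1 hν) v).trans ?_
      refine iff_of_eq (congrArg (PositiveFrame (X.orient (X.incl s))) (funext fun i => ?_))
      -- Entry `0` is the outward vector `ν` on both sides; only the tangential entries involve the
      -- differential of the inclusion.
      refine Fin.cases rfl (fun i => ?_) i
      exact (mfderiv_sumMap_incl_inl X Y s (v i)).symm
    · refine (Y.boundary_orient t ν ((isOutward_inr _ _).1 hν) v).trans ?_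
      refine iff_of_eq (congrArg (PositiveFrame (Y.orient (Y.incl t))) (funext fun i => ?_))
      refine Fin.cases rfl (fun i => ?_) i
      exact (mfderiv_sumMap_incl_inr X Y t (v i)).symm

/-- The same manifold, its boundary identified with `S` by means of an orientation-preserving
diffeomorphism `f : S → T`. -/
noncomputable abbrev reparam (X : ManifoldWithBoundary T) (f : S ≃ₘ⟮𝓡 m, 𝓡 m⟯ T)
    (hf : IsOrientedDiffeo S T f) : ManifoldWithBoundary S :=
  have hd (s : S) : mfderiv (𝓡 m) (𝓡∂ (m + 1)) (X.incl ∘ f) s =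
      (mfderiv (𝓡 m) (𝓡∂ (m + 1)) X.incl (f s)).comp (mfderiv (𝓡 m) (𝓡 m) f s) :=
    mfderiv_comp s (X.mdifferentiable_incl _) (f.mdifferentiable (by simp) _)
  { carrier := X.carrier
    orient := X.orient
    isOrientation := X.isOrientation
    incl := X.incl ∘ f
    contMDiff_incl := X.contMDiff_incl.comp f.contMDiff
    isEmbedding_incl := X.isEmbedding_incl.comp f.toHomeomorph.isEmbedding
    mfderiv_incl_injective := fun s => by
      rw [hd]
      exact (X.mfderiv_incl_injective (f s)).comp
        (f.mfderivToContinuousLinearEquiv (by simp) s).injective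
    range_incl := (f.surjective.range_comp X.incl).trans X.range_incl
    boundary_orient := fun s ν hν v => by
      rw [hd]
      -- The point and the outward vector are those of `X` at `f s`, and `f` matches positive frames
      -- of `S` with those of `T`.
      exact (hf s v).trans (X.boundary_orient (f s) ν hν _) }

end ManifoldWithBoundary

/-! ### Gluings of disjoint unions -/

section Gluing

variable {m : ℕ} {S T S' T' : ClosedManifold.{u} m}

theorem IsOrientedEmbedding.sum {X : ManifoldWithBoundary S} {Y : ManifoldWithBoundary T}
    {M N : ClosedManifold.{u} (m + 1)} {i : X → M} {j : Y → N} (hi : IsOrientedEmbedding X M i)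
    (hj : IsOrientedEmbedding Y N j) :
    IsOrientedEmbedding (X.sum Y) (M.sum N) (Sum.map i j) where
  contMDiff := hi.contMDiff.sumMap hj.contMDiff
  isEmbedding := ((hi.contMDiff.sumMap hj.contMDiff).continuous.isClosedEmbedding
    (hi.isEmbedding.injective.sumMap hj.isEmbedding.injective)).isEmbedding
  preservesOrientation :=
    hi.preservesOrientation.sumMap hj.preservesOrientation hi.contMDiff hj.contMDiff

theorem IsOrientedEmbedding.comp_swap {X : ManifoldWithBoundary S} {Y : ManifoldWithBoundary T}
    {M : ClosedManifold.{u} (m + 1)} {i : X.sum Y → M} (hi : IsOrientedEmbedding (X.sum Y) M i) :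
    IsOrientedEmbedding (Y.sum X) M (i ∘ Sum.swap) where
  contMDiff := hi.contMDiff.comp ContMDiff.swap
  isEmbedding := hi.isEmbedding.comp (Homeomorph.sumComm Y X).isEmbedding
  preservesOrientation := hi.preservesOrientation.comp (preservesOrientation_swap _)
    (hi.contMDiff.mdifferentiable (by simp))
    ((ContMDiff.swap (n := 1)).mdifferentiable (by simp))

theorem IsGluing.sum {X : ManifoldWithBoundary S} {Y : ManifoldWithBoundary T}
    {X' : ManifoldWithBoundary S'} {Y' : ManifoldWithBoundary T'} {f : S ≃ₘ⟮𝓡 m, 𝓡 m⟯ T}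
    {f' : S' ≃ₘ⟮𝓡 m, 𝓡 m⟯ T'} {M M' : ClosedManifold.{u} (m + 1)}
    (h : IsGluing X Y f M) (h' : IsGluing X' Y' f' M') :
    IsGluing (X.sum X') (Y.sum Y') (f.sumCongr f') (M.sum M') := by
  obtain ⟨i, j, hi, hj, hu, he⟩ := h
  obtain ⟨i', j', hi', hj', hu', he'⟩ := h'
  refine ⟨Sum.map i i', Sum.map j j', hi.sum hi', hj.sum hj', ?_, ?_⟩
  · refine Set.eq_univ_of_forall ?_
    rintro (z | z)
    · rcases hu.ge (Set.mem_univ z) with ⟨x, rfl⟩ | ⟨y, rfl⟩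
      exacts [.inl ⟨.inl x, rfl⟩, .inr ⟨.inl y, rfl⟩]
    · rcases hu'.ge (Set.mem_univ z) with ⟨x, rfl⟩ | ⟨y, rfl⟩
      exacts [.inl ⟨.inr x, rfl⟩, .inr ⟨.inr y, rfl⟩]
  -- In the mixed cases both sides are false: the images lie in different summands, and `f.sumCongr
  -- f'` respects the summands.
  · rintro (x | x) (y | y) <;> simp [he, he']

/-- A relator needs literally the same right piece in its gluings. Exchanging the two summands moves
the crossing into the gluing map and leaves `M` unchanged. -/
theorem IsGluing.trans_sumComm {X : ManifoldWithBoundary S} {Y : ManifoldWithBoundary T}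
    {Y' : ManifoldWithBoundary T'} {f : S ≃ₘ⟮𝓡 m, 𝓡 m⟯ (T.sum T')}
    {M : ClosedManifold.{u} (m + 1)} (h : IsGluing X (Y.sum Y') f M) :
    IsGluing X (Y'.sum Y) (f.trans (Diffeomorph.sumComm (𝓡 m) T ∞ T')) M := by
  obtain ⟨i, j, hi, hj, hu, he⟩ := h
  refine ⟨i, j ∘ Sum.swap, hi, hj.comp_swap, ?_, fun x y => ?_⟩
  · have hr : Set.range (j ∘ Sum.swap) = Set.range j :=
      (Equiv.sumComm Y' Y).surjective.range_comp j
    rwa [hr]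
  · refine (he x y.swap).trans (exists_congr fun s => and_congr_right fun _ => ?_)
    change Sum.map Y.incl Y'.incl (f s) = y.swap ↔ Sum.map Y'.incl Y.incl (f s).swap = y
    cases f s <;> cases y <;> simp

/-- The same two embeddings work, because relabelling changes neither the carrier nor its
orientation; the matching condition is reindexed by `t = f s`. -/
theorem IsGluing.reparam {X : ManifoldWithBoundary T} {Y : ManifoldWithBoundary T'}
    {k : T ≃ₘ⟮𝓡 m, 𝓡 m⟯ T'} {M : ClosedManifold.{u} (m + 1)} (h : IsGluing X Y k M)
    (f : S ≃ₘ⟮𝓡 m, 𝓡 m⟯ T) (hf : IsOrientedDiffeo S T f) :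
    IsGluing (X.reparam f hf) Y (f.trans k) M := by
  obtain ⟨i, j, hi, hj, hu, he⟩ := h
  refine ⟨i, j, ⟨hi.1, hi.2, hi.3⟩, hj, hu, fun x y => (he x y).trans ?_⟩
  exact (f.surjective.exists (p := fun t => X.incl t = x ∧ Y.incl (k t) = y))

/-- A map glued to a reversed piece `X.reverse` must preserve orientation into the reverse of
`T.reverse`. -/
theorem IsOrientedDiffeo.reverse_reverse {f : S ≃ₘ⟮𝓡 m, 𝓡 m⟯ T} (hf : IsOrientedDiffeo S T f) :
    IsOrientedDiffeo S T.reverse.reverse f := by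
  unfold IsOrientedDiffeo at hf ⊢
  simpa only [orientation_neg_neg] using hf

theorem IsOrientedDiffeo.sum {f : S ≃ₘ⟮𝓡 m, 𝓡 m⟯ T} {f' : S' ≃ₘ⟮𝓡 m, 𝓡 m⟯ T'}
    (hf : IsOrientedDiffeo S T.reverse f) (hf' : IsOrientedDiffeo S' T'.reverse f') :
    IsOrientedDiffeo (S.sum S') (T.sum T').reverse (f.sumCongr f') := by
  have h := PreservesOrientation.sumMap hf hf' f.contMDiff f'.contMDiff
  rwa [sumOrient_neg] at h

theorem IsOrientedDiffeo.trans_sumComm {f : S ≃ₘ⟮𝓡 m, 𝓡 m⟯ (T.sum T')}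
    (hf : IsOrientedDiffeo S (T.sum T').reverse f) :
    IsOrientedDiffeo S (T'.sum T).reverse (f.trans (Diffeomorph.sumComm (𝓡 m) T ∞ T')) := by
  have h := preservesOrientation_swap (𝓡 m) (o₁ := fun x => -T.orient x)
    (o₂ := fun x => -T'.orient x)
  rw [sumOrient_neg, sumOrient_neg] at h
  exact h.comp hf ((ContMDiff.swap (n := 1)).mdifferentiable (by simp))
    (f.mdifferentiable (by simp))

end Gluing

/-! ### Computing in the SKK group -/

theorem SKK.mk_sum {n : ℕ} (M N : ClosedManifold.{u} n) :
    SKK.mk (M.sum N) = SKK.mk M + SKK.mk N := by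
  have h : ManifoldGroup.mk (M.sum N) = ManifoldGroup.mk M + ManifoldGroup.mk N :=
    map_add (Algebra.GrothendieckAddGroup.of (M := ManifoldClass.{u} n))
      (show ManifoldClass.{u} n from Quotient.mk (ClosedManifold.setoid n) M)
      (show ManifoldClass.{u} n from Quotient.mk (ClosedManifold.setoid n) N)
  unfold SKK.mk
  rw [h, QuotientAddGroup.mk_add]

/-- The defining relation of `SKK`. -/
theorem SKK.mk_add_mk_eq {m : ℕ} {S T : ClosedManifold.{u} m} {X₁ Y₁ : ManifoldWithBoundary S}
    {X₂ Y₂ : ManifoldWithBoundary T} {f g : S ≃ₘ⟮𝓡 m, 𝓡 m⟯ T}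
    {M N M' N' : ClosedManifold.{u} (m + 1)}
    (hf : IsOrientedDiffeo S T.reverse f) (hg : IsOrientedDiffeo S T.reverse g)
    (hM : IsGluing X₁ X₂ f M) (hN : IsGluing X₁ X₂ g N)
    (hM' : IsGluing Y₁ Y₂ f M') (hN' : IsGluing Y₁ Y₂ g N') :
    SKK.mk M + SKK.mk N' = SKK.mk N + SKK.mk M' := by
  have h : (QuotientAddGroup.mk (ManifoldGroup.mk M - ManifoldGroup.mk N - ManifoldGroup.mk M' +
      ManifoldGroup.mk N') : SKK.{u} (m + 1)) = 0 :=
    (QuotientAddGroup.eq_zero_iff _).2 (AddSubgroup.subset_closure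
      ⟨S, T, X₁, Y₁, X₂, Y₂, f, g, M, N, M', N', hf, hg, hM, hN, hM', hN', rfl⟩)
  rw [QuotientAddGroup.mk_add, QuotientAddGroup.mk_sub, QuotientAddGroup.mk_sub] at h
  have h' : SKK.mk M - SKK.mk N - SKK.mk M' + SKK.mk N' = 0 := h
  -- The difference of the two sides is the relator itself.
  rw [← sub_eq_zero, ← h']
  abel

end CutPaste

/- Both `A ⊔ B` and `C ⊔ D` arise by gluing `X₁ ⊔ X₂` and `X₂.reverse ⊔ X₃`. Replacing `X₁` by
another copy of `X₂`, both gluings become the disjoint union of `D` and `B`. -/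
theorem mainTheorem5 {m : ℕ} (S₁ S₂ S₃ : CutPaste.ClosedManifold.{u} m)
    (X₁ : CutPaste.ManifoldWithBoundary S₁) (X₂ : CutPaste.ManifoldWithBoundary S₂)
    (X₃ : CutPaste.ManifoldWithBoundary S₃)
    (f : S₁ ≃ₘ⟮𝓡 m, 𝓡 m⟯ S₂) (hf : CutPaste.IsOrientedDiffeo S₁ S₂ f)
    (g : S₂ ≃ₘ⟮𝓡 m, 𝓡 m⟯ S₃) (hg : CutPaste.IsOrientedDiffeo S₂ S₃.reverse g)
    (A B C D : CutPaste.ClosedManifold.{u} (m + 1))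
    (hA : CutPaste.IsGluing X₁ X₂.reverse f A)
    (hB : CutPaste.IsGluing X₂ X₃ g B)
    (hC : CutPaste.IsGluing X₁ X₃ (f.trans g) C)
    (hD : CutPaste.IsDouble X₂ D) :
    CutPaste.SKK.mk A + CutPaste.SKK.mk B = CutPaste.SKK.mk C + CutPaste.SKK.mk D := by
  -- `X₂.reparam f hf` has boundary `S₁`, so it can stand in for `X₁`: glued to `X₃` along `g ∘ f`
  -- it gives `B`, and glued to `X₂.reverse` along `f` it gives `D`.
  have hB' := hB.reparam f hf
  have hD' := CutPaste.IsGluing.reparam hD f hf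
  have hid : CutPaste.IsOrientedDiffeo S₂ S₂.reverse.reverse (Diffeomorph.refl (𝓡 m) S₂ ∞) :=
    CutPaste.IsOrientedDiffeo.reverse_reverse (CutPaste.preservesOrientation_id (𝓡 m) S₂.orient)
  have hgf : CutPaste.IsOrientedDiffeo S₁ S₃.reverse (f.trans g) :=
    CutPaste.PreservesOrientation.comp (g := g) (f := f) hg hf (g.mdifferentiable (by simp))
      (f.mdifferentiable (by simp))
  -- The four gluings are `A ⊔ B`, `C ⊔ D`, `D ⊔ B` and `B ⊔ D`, all with right piece `X₂.reverse ⊔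
  -- X₃`. The composite of `f` with the identity in `hD'` unifies with `f`.
  have key := CutPaste.SKK.mk_add_mk_eq (hf.reverse_reverse.sum hg) (hgf.sum hid).trans_sumComm
    (hA.sum hB) (hC.sum hD).trans_sumComm (hD'.sum hB) (hB'.sum hD).trans_sumComm
  simp only [CutPaste.SKK.mk_sum] at key
  -- Both sides now carry the same extra summand `[D] + [B]`, which cancels.
  rw [add_comm (CutPaste.SKK.mk B) (CutPaste.SKK.mk D)] at key
  exact add_right_cancel key
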